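/- Let $\mu\neq\delta_1$ be a probability measure on $\mathbb N=\{0,1,2,\dots\}$ with mean $1$ and finite variance. Let $(\mathcal T_k)_{k\ge 0}$ be independent $\mu$-Galton–Watson plane trees, let $(w_k)_{k\ge 0}$ be an infinite ray (the spine), in which $w_{k}$ is the parent of $w_{k+1}$, and attach to every $w_k$ the tree $\mathcal T_k$, so that $w_k$ is the root of $\mathcal T_k$. Let $\mathcal T$ be the resulting infinite tree, rooted at $\varnothing:=w_0$, and let $\mathtt d$ be its graph distance. Almost surely all $\mathcal T_k$ are finite, so that the vertices of $\mathcal T$ can be enumerated as a sequence $(u_i)_{i\ge 0}$ by listing first the vertices of $\mathcal T_0$ in depth-first (lexicographical) order, starting at $u_0=\varnothing$, then those of $\mathcal T_1$ in depth-first order, starting at $w_1$, and so on. Then almost surely \[ \max_{0\le i\le n}\mathtt d(\varnothing,u_i)=n^{\frac12+o(1)}\qquad (n\to\infty), \] that is, almost surely there is a (random) real sequence $(\varepsilon_n)$ with $\varepsilon_n\to 0$ and $\max_{0\le i\le n}\mathtt d(\varnothing,u_i)=n^{\frac12+\varepsilon_n}$ for all $n$. -/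

import Mathlib

open MeasureTheory ProbabilityTheory Filter Topology

/-- The plane tree in which the vertex `p` (a finite word of natural numbers) has `c p` children,
namely `p ++ [0], …, p ++ [c p - 1]`; the root is the empty word. -/
def planeTree (c : List ℕ → ℕ) : Set (List ℕ) :=
  {w | ∀ (p : List ℕ) (j : ℕ), p ++ [j] <+: w → j < c p}

/-- The vertices of the forest obtained by attaching the plane tree with child counts `c k` to the
`k`-th spine vertex `w_k`, for every `k`. The pair `(k, w)` is the vertex `w` of the `k`-th tree, so
that `(k, [])` is `w_k`. The lexicographic order of `ℕ ×ₗ List ℕ` (with the lexicographic order on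
words) visits the trees one after another, each of them in depth-first order. -/
def forest (c : ℕ → List ℕ → ℕ) : Set (ℕ ×ₗ List ℕ) :=
  {v | (ofLex v).2 ∈ planeTree (c (ofLex v).1)}

/-- `u` is the parent of `v`: either `v` is a child of `u` in one of the trees, or `u = w_k` and
`v = w_{k+1}` are consecutive spine vertices. -/
def IsParent (u v : ℕ ×ₗ List ℕ) : Prop :=
  (∃ (k : ℕ) (w : List ℕ) (j : ℕ), u = toLex (k, w) ∧ v = toLex (k, w ++ [j])) ∨
    ∃ k : ℕ, u = toLex (k, []) ∧ v = toLex (k + 1, [])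

/-- The forest as a graph (an infinite tree, thanks to the spine). -/
def forestGraph (c : ℕ → List ℕ → ℕ) : SimpleGraph (forest c) :=
  SimpleGraph.fromRel fun u v => IsParent (u : ℕ ×ₗ List ℕ) (v : ℕ ×ₗ List ℕ)

/-- The root `∅ = w_0` of the forest. -/
def forestRoot (c : ℕ → List ℕ → ℕ) : forest c :=
  ⟨toLex (0, []), fun p j h => by simp at h⟩

/-!
If the vertices `u 0, …, u n` all have height less than `m`, they lie in the first `m` trees, at
distance less than `m` from the spine, where the expected number of vertices is `m ^ 2`: hence the
maximal height is at least of order `√n`. Conversely, the generating function of the total progeny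
of a critical tree has a square root singularity at `1`, so that the first `m` trees contain more
than `n` vertices as soon as `m` is much larger than `√n`, whereas by Kolmogorov's estimate none of
them reaches a height much larger than `m`. For `n = 4 ^ j` and `θ > 1`, conceding factors of order
`θ ^ j` makes the failure probabilities geometrically small in `j`; the Borel–Cantelli lemma,
monotonicity in `n` and `θ ↓ 1` conclude.
-/

section RealAnalysis

lemma one_sub_mul_add_sq_le_pow {q : ℝ} (h0 : 0 ≤ q) (h1 : q ≤ 1) {n : ℕ} (hn : 2 ≤ n) :
    1 - n * q + q ^ 2 ≤ (1 - q) ^ n := by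
  induction n, hn using Nat.le_induction with
  | base => norm_num; linarith
  | succ n _ ih =>
    have hpow : q * (1 - q) ^ n ≤ q :=
      mul_le_of_le_one_right h0 (pow_le_one₀ (by linarith) (by linarith))
    push_cast
    linarith [pow_succ (1 - q) n]

lemma pow_le_one_sub_mul_add_sq {q : ℝ} (h0 : 0 ≤ q) (h1 : q ≤ 1) (n : ℕ) :
    (1 - q) ^ n ≤ 1 - n * q + n ^ 2 * q ^ 2 := by
  induction n with
  | zero => simp
  | succ n ih =>
    have hmul : (1 - q) ^ (n + 1) ≤ (1 - n * q + n ^ 2 * q ^ 2) * (1 - q) :=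
      pow_succ (1 - q) n ▸ mul_le_mul_of_nonneg_right ih (by linarith)
    have hcubic : 0 ≤ (n : ℝ) ^ 2 * q ^ 3 := by positivity
    have hquadratic : 0 ≤ ((n : ℝ) + 1) * q ^ 2 := by positivity
    push_cast
    linarith

lemma le_one_div_one_add_mul {q : ℕ → ℝ} {p : ℝ} (hp : 0 ≤ p) (hq : ∀ h, 0 ≤ q h) (h0 : q 0 ≤ 1)
    (hstep : ∀ h, q (h + 1) ≤ q h - p * q h ^ 2) (h : ℕ) : q h ≤ 1 / (1 + p * h) := by
  induction h with
  | zero => simpa using h0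
  | succ h ih =>
    have hpq : 0 ≤ p * q h := mul_nonneg hp (hq h)
    calc q (h + 1) ≤ q h - p * q h ^ 2 := hstep h
      _ ≤ q h / (1 + p * q h) := by
          rw [le_div_iff₀ (by positivity)]
          linarith [mul_nonneg (hq h) (mul_nonneg hpq hpq)]
      _ ≤ 1 / (1 + p * (h + 1 : ℕ)) := by
          rw [le_div_iff₀ (by positivity)] at ih
          rw [div_le_div_iff₀ (by positivity) (by positivity)]
          push_cast
          linarith

lemma add_le_one_sub_one_sub_mul {q ε C : ℝ} (hq : 0 ≤ q) (hε0 : 0 ≤ ε) (hε1 : ε ≤ 1) (hC : 0 ≤ C)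
    (hqε : 2 * (C + 1) * q ≤ √ε) : q + ε / 4 ≤ 1 - (1 - ε) * (1 - q + C * q ^ 2) := by
  have hhalf : q ≤ 1 / 2 := by
    linarith [mul_nonneg hC hq, Real.sqrt_le_one.2 hε1]
  have hsq : 4 * (C + 1) ^ 2 * q ^ 2 ≤ ε := by
    calc 4 * (C + 1) ^ 2 * q ^ 2 = (2 * (C + 1) * q) ^ 2 := by ring
      _ ≤ √ε ^ 2 := by gcongr
      _ = ε := Real.sq_sqrt hε0
  have hCq : C * q ^ 2 ≤ ε / 4 := by
    have : C ≤ (C + 1) ^ 2 := by nlinarith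
    linarith [mul_le_mul_of_nonneg_right this (sq_nonneg q)]
  linarith [mul_le_mul_of_nonneg_left hhalf hε0, mul_nonneg hε0 (mul_nonneg hC (sq_nonneg q))]

lemma one_sub_pow_le_one_div {x : ℝ} (hx0 : 0 < x) (hx1 : x ≤ 1) {m : ℕ} (hm : m ≠ 0) :
    (1 - x) ^ m ≤ 1 / (m * x) := by
  calc (1 - x) ^ m ≤ Real.exp (-x) ^ m := by
        gcongr
        exact Real.one_sub_le_exp_neg x
    _ = 1 / Real.exp (m * x) := by rw [← Real.exp_nat_mul, mul_neg, Real.exp_neg, one_div]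
    _ ≤ 1 / (m * x) := by
        gcongr
        linarith [Real.add_one_le_exp (m * x)]

lemma natCast_ceil_le_two_mul {x : ℝ} (hx : 1 ≤ x) : (⌈x⌉₊ : ℝ) ≤ 2 * x := by
  linarith [Nat.ceil_lt_add_one (show 0 ≤ x by linarith)]

lemma tendsto_log_div_of_geometric_bounds {ι : Type*} {l : Filter ι} [l.NeBot] {a : ℕ → ℝ}
    {x y : ι → ℝ} {b C : ℝ} (hb : 0 < b) (hC : 0 < C) (hx : Tendsto x l (𝓝 b))
    (hy : Tendsto y l (𝓝 b)) (hlower : ∀ i, ∀ᶠ j in atTop, x i ^ j ≤ a j)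
    (hupper : ∀ i, ∀ᶠ j in atTop, a j ≤ C * y i ^ j) :
    Tendsto (fun j : ℕ => Real.log (a j) / j) atTop (𝓝 (Real.log b)) := by
  refine tendsto_order.2 ⟨fun t ht => ?_, fun t ht => ?_⟩
  · obtain ⟨i, hxi, hti⟩ := ((hx.eventually_const_lt hb).and
      ((hx.log hb.ne').eventually_const_lt ht)).exists
    filter_upwards [hlower i, eventually_gt_atTop 0] with j hj hj0
    refine hti.trans_le ((le_div_iff₀' (by positivity)).2 ?_)
    rw [← Real.log_pow]
    exact Real.log_le_log (by positivity) hj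
  · obtain ⟨i, hxi⟩ := (hx.eventually_const_lt hb).exists
    obtain ⟨i', hyi, hti⟩ := ((hy.eventually_const_lt hb).and
      ((hy.log hb.ne').eventually_lt_const ht)).exists
    have hlim : Tendsto (fun j : ℕ => Real.log C / j + Real.log (y i')) atTop
        (𝓝 (Real.log (y i'))) := by
      simpa using (tendsto_const_div_atTop_nhds_zero_nat (Real.log C)).add_const (Real.log (y i'))
    filter_upwards [hlower i, hupper i', hlim.eventually_lt_const hti, eventually_gt_atTop 0]
      with j hlow hupp hjt hj0
    refine lt_of_le_of_lt ?_ hjt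
    have hlog : Real.log (a j) ≤ Real.log C + j * Real.log (y i') := by
      rw [← Real.log_pow, ← Real.log_mul hC.ne' (by positivity)]
      exact Real.log_le_log ((pow_pos hxi j).trans_le hlow) hupp
    calc Real.log (a j) / j ≤ (Real.log C + j * Real.log (y i')) / j := by gcongr
      _ = Real.log C / j + Real.log (y i') := by field_simp

lemma tendsto_div_log_of_monotone {f : ℕ → ℝ} (hf : Monotone f) (hf0 : 0 ≤ f) {b : ℕ} (hb : 1 < b)
    {L : ℝ} (hL : Tendsto (fun j : ℕ => f (b ^ j) / j) atTop (𝓝 L)) :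
    Tendsto (fun n : ℕ => f n / Real.log n) atTop (𝓝 (L / Real.log b)) := by
  have hlogb : 0 < Real.log b := Real.log_pos (by exact_mod_cast hb)
  have hratio : Tendsto (fun j : ℕ => (j : ℝ) / (j + 1)) atTop (𝓝 1) :=
    tendsto_natCast_div_add_atTop 1
  have hlower : Tendsto (fun j : ℕ => f (b ^ j) / ((j + 1) * Real.log b)) atTop
      (𝓝 (L / Real.log b)) := by
    refine ((hL.mul hratio).div_const (Real.log b)).congr' ?_ |>.trans (by simp)
    filter_upwards [eventually_gt_atTop 0] with j hj
    field_simp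
  have hupper : Tendsto (fun j : ℕ => f (b ^ (j + 1)) / (j * Real.log b)) atTop
      (𝓝 (L / Real.log b)) := by
    have hL' := hL.comp (tendsto_add_atTop_nat 1)
    refine ((hL'.div hratio one_ne_zero).div_const (Real.log b)).congr' ?_ |>.trans (by simp)
    filter_upwards [eventually_gt_atTop 0] with j hj
    simp only [Function.comp_apply, Pi.div_apply]
    push_cast
    field_simp
  have hlog : Tendsto (Nat.log b) atTop atTop :=
    tendsto_atTop_atTop_of_monotone Nat.log_monotone fun j => ⟨b ^ j, (Nat.log_pow hb j).ge⟩
  refine tendsto_of_tendsto_of_tendsto_of_le_of_le' (hlower.comp hlog) (hupper.comp hlog) ?_ ?_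
  · filter_upwards [eventually_gt_atTop 1] with n hn
    have hlogn : Real.log n ≤ (Nat.log b n + 1) * Real.log b := by
      have hlt : (n : ℝ) ≤ b ^ (Nat.log b n + 1) := by
        exact_mod_cast (Nat.lt_pow_succ_log_self hb n).le
      simpa [Real.log_pow] using Real.log_le_log (by positivity) hlt
    exact div_le_div₀ (hf0 n) (hf (Nat.pow_log_le_self b (by lia)))
      (Real.log_pos (by exact_mod_cast hn)) hlogn
  · filter_upwards [eventually_ge_atTop b] with n hn
    have hlogn : Nat.log b n * Real.log b ≤ Real.log n := by
      have hle : (b : ℝ) ^ Nat.log b n ≤ n := by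
        exact_mod_cast Nat.pow_log_le_self b (by lia)
      simpa [Real.log_pow] using Real.log_le_log (by positivity) hle
    have hpos : 0 < Nat.log b n := Nat.log_pos hb hn
    exact div_le_div₀ (hf0 _) (hf (Nat.lt_pow_succ_log_self hb n).le) (by positivity) hlogn

lemma exists_eq_rpow_add_of_tendsto_log_div_log {f : ℕ → ℝ} {L : ℝ} (hL0 : L ≠ 0) (h0 : f 0 = 0)
    (h1 : f 1 = 1) (hpos : ∀ n, n ≠ 0 → 0 < f n)
    (hL : Tendsto (fun n : ℕ => Real.log (f n) / Real.log n) atTop (𝓝 L)) :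
    ∃ ε : ℕ → ℝ, Tendsto ε atTop (𝓝 0) ∧ ∀ n : ℕ, f n = (n : ℝ) ^ (L + ε n) := by
  -- At `n = 0` the quotient of logarithms is `0`, but `0 ^ 0 = 1`.
  refine ⟨fun n => if n = 0 then 0 else Real.log (f n) / Real.log n - L, ?_, fun n => ?_⟩
  · refine (tendsto_sub_nhds_zero_iff.2 hL).congr' ?_
    filter_upwards [eventually_ne_atTop 0] with n hn
    rw [if_neg hn]
  · obtain rfl | rfl | hn : n = 0 ∨ n = 1 ∨ 1 < n := by lia
    · simp [h0, hL0]
    · simp [h1]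
    · have hn1 : (1 : ℝ) < n := by exact_mod_cast hn
      simp only [if_neg (show n ≠ 0 by lia), add_sub_cancel]
      exact (Real.rpow_logb (by linarith) hn1.ne' (hpos n (by lia))).symm

end RealAnalysis

section InfiniteProduct

variable {ι : Type*}

lemma indepFun_eval_nil_eval_cons {E : Type*} [MeasurableSpace E] (ν : Measure E)
    [IsProbabilityMeasure ν] :
    (fun c : List ι → E => c []) ⟂ᵢ[Measure.infinitePi fun _ => ν]
      fun c (p : ι × List ι) => c (p.1 :: p.2) := by
  classical
  have hindep : iIndepFun (fun (w : List ι) (c : List ι → E) => c w)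
      (Measure.infinitePi fun _ => ν) := iIndepFun_infinitePi fun _ => measurable_id
  refine IndepFun.indepFun_process (by fun_prop) (by fun_prop) fun I => ?_
  let J : Finset (List ι) := I.image fun p => p.1 :: p.2
  have hdisj : Disjoint {[]} J := by simp [J]
  exact (hindep.indepFun_finset _ J hdisj fun _ => measurable_pi_apply _).comp
    (measurable_pi_apply (⟨[], Finset.mem_singleton_self _⟩ : ({[]} : Finset (List ι))))
    (measurable_pi_lambda (fun (y : J → E) (p : I) => y ⟨_, Finset.mem_image_of_mem _ p.2⟩)
      fun _ => measurable_pi_apply _)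

lemma map_infinitePi_list {E : Type*} [MeasurableSpace E] (ν : Measure E)
    [IsProbabilityMeasure ν] :
    (Measure.infinitePi fun _ : List ι => ν).map (fun c => (c [], fun i w => c (i :: w))) =
      ν.prod (Measure.infinitePi fun _ : ι => Measure.infinitePi fun _ : List ι => ν) := by
  have hcons : Function.Injective fun p : ι × List ι => p.1 :: p.2 := fun p p' h => by
    simpa [Prod.ext_iff] using h
  have hcurry : Measurable fun (d : ι × List ι → E) i w => d (i, w) := by fun_prop
  have htails : (Measure.infinitePi fun _ : List ι => ν).map (fun c i w => c (i :: w)) =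
      Measure.infinitePi fun _ : ι => Measure.infinitePi fun _ : List ι => ν := by
    rw [← Measure.infinitePi_map_curry fun _ _ => ν,
      ← Measure.map_infinitePi_infinitePi_of_inj (P := fun _ => ν) hcons,
      Measure.map_map (MeasurableEquiv.measurable _) (by fun_prop)]
    rfl
  have hindep : IndepFun (fun c : List ι → E => c []) (fun c i w => c (i :: w))
      (Measure.infinitePi fun _ => ν) :=
    (indepFun_eval_nil_eval_cons ν).comp measurable_id hcurry
  have hprod := (indepFun_iff_map_prod_eq_prod_map_map (measurable_pi_apply []).aemeasurable
    (Measurable.aemeasurable (by fun_prop))).1 hindep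
  rwa [htails, Measure.infinitePi_map_eval] at hprod

lemma integral_finset_prod_infinitePi {X : ι → Type*} [∀ i, MeasurableSpace (X i)]
    (ν : ∀ i, Measure (X i)) [∀ i, IsProbabilityMeasure (ν i)] (s : Finset ι) {f : ∀ i, X i → ℝ}
    (hf : ∀ i, Measurable (f i)) :
    ∫ x, ∏ i ∈ s, f i (x i) ∂Measure.infinitePi ν = ∏ i ∈ s, ∫ x, f i x ∂ν i := by
  have hmeas : Measurable fun y : ∀ i : s, X i => ∏ i : s, f i (y i) := by fun_prop
  calc ∫ x, ∏ i ∈ s, f i (x i) ∂Measure.infinitePi ν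
      = ∫ x, ∏ i : s, f i (s.restrict x i) ∂Measure.infinitePi ν :=
        integral_congr_ae (ae_of_all _ fun x => (Finset.prod_coe_sort s fun i => f i (x i)).symm)
    _ = ∫ y, ∏ i : s, f i (y i) ∂Measure.pi fun i : s => ν i :=
        integral_restrict_infinitePi ν hmeas.aestronglyMeasurable
    _ = ∏ i : s, ∫ x, f i x ∂ν i := integral_fintype_prod_eq_prod (𝕜 := ℝ) fun i : s => f i
    _ = ∏ i ∈ s, ∫ x, f i x ∂ν i := Finset.prod_coe_sort s fun i => ∫ x, f i x ∂ν i

end InfiniteProduct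

section ProbabilityGeneratingFunction

/-- The probability generating function `t ↦ 𝔼[t ^ X]` of an `ℕ`-valued random variable `X`. -/
noncomputable def pgf {E : Type*} [MeasurableSpace E] (X : E → ℕ) (ν : Measure E) (t : ℝ) : ℝ :=
  ∫ x, t ^ X x ∂ν

variable {E : Type*} [MeasurableSpace E] {ν : Measure E} [IsProbabilityMeasure ν] {X : E → ℕ}

lemma integrable_pow_of_mem_Icc (hX : Measurable X) {t : ℝ} (ht : t ∈ Set.Icc 0 1) :
    Integrable (fun x => t ^ X x) ν := by
  refine Integrable.of_bound (C := 1) (Measurable.aestronglyMeasurable (by fun_prop))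
    (ae_of_all _ fun x => ?_)
  rw [Real.norm_of_nonneg (pow_nonneg ht.1 _)]
  exact pow_le_one₀ ht.1 ht.2

lemma pgf_mem_Icc (hX : Measurable X) {t : ℝ} (ht : t ∈ Set.Icc 0 1) :
    pgf X ν t ∈ Set.Icc 0 1 := by
  refine ⟨integral_nonneg fun x => pow_nonneg ht.1 _, ?_⟩
  calc pgf X ν t ≤ ∫ _, (1 : ℝ) ∂ν := integral_mono (integrable_pow_of_mem_Icc hX ht)
        (integrable_const 1) fun x => pow_le_one₀ ht.1 ht.2
    _ = 1 := by simp

lemma one_sub_pgf_mem_Icc (hX : Measurable X) {t : ℝ} (ht : t ∈ Set.Icc 0 1) :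
    1 - pgf X ν t ∈ Set.Icc 0 1 := by
  obtain ⟨h0, h1⟩ := pgf_mem_Icc (ν := ν) hX ht
  exact ⟨by linarith, by linarith⟩

lemma one_sub_pgf_zero (hX : Measurable X) : 1 - pgf X ν 0 = ν.real {x | X x ≠ 0} := by
  have hset : MeasurableSet {x | X x = 0} := hX (measurableSet_singleton 0)
  have hpgf : pgf X ν 0 = ν.real {x | X x = 0} := by
    rw [← integral_indicator_one hset]
    refine integral_congr_ae (ae_of_all _ fun x => ?_)
    by_cases hx : X x = 0 <;> simp [hx]
  rw [hpgf, ← probReal_compl_eq_one_sub hset]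
  rfl

lemma le_pgf_one_sub (hX : Measurable X) (hint : Integrable (fun x => (X x : ℝ)) ν) {q : ℝ}
    (hq : q ∈ Set.Icc 0 1) :
    1 - (∫ x, (X x : ℝ) ∂ν) * q + ν.real {x | 2 ≤ X x} * q ^ 2 ≤ pgf X ν (1 - q) := by
  have hset : MeasurableSet {x | 2 ≤ X x} := measurableSet_le measurable_const hX
  have hlinear : Integrable (fun x => 1 - X x * q) ν := (integrable_const 1).sub (hint.mul_const q)
  have hquadratic : Integrable ({x | 2 ≤ X x}.indicator fun _ => q ^ 2) ν :=
    (integrable_const _).indicator hset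
  calc 1 - (∫ x, (X x : ℝ) ∂ν) * q + ν.real {x | 2 ≤ X x} * q ^ 2
      = ∫ x, (1 - X x * q + {x | 2 ≤ X x}.indicator (fun _ => q ^ 2) x) ∂ν := by
        rw [integral_add hlinear hquadratic, integral_indicator_const _ hset,
          integral_sub (integrable_const 1) (hint.mul_const q), integral_mul_const]
        simp
    _ ≤ pgf X ν (1 - q) := by
        refine integral_mono (hlinear.add hquadratic)
          (integrable_pow_of_mem_Icc hX ⟨by linarith [hq.2], by linarith [hq.1]⟩) fun x => ?_
        by_cases hx : 2 ≤ X x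
        · simpa [hx] using one_sub_mul_add_sq_le_pow hq.1 hq.2 hx
        · simpa [hx, ← sub_eq_add_neg] using one_add_mul_le_pow (by linarith [hq.2]) (X x) (a := -q)

lemma pgf_one_sub_le (hX : Measurable X) (hvar : MemLp (fun x => (X x : ℝ)) 2 ν) {q : ℝ}
    (hq : q ∈ Set.Icc 0 1) :
    pgf X ν (1 - q) ≤ 1 - (∫ x, (X x : ℝ) ∂ν) * q + (∫ x, (X x : ℝ) ^ 2 ∂ν) * q ^ 2 := by
  have hint : Integrable (fun x => (X x : ℝ)) ν := hvar.integrable one_le_two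
  have hlinear : Integrable (fun x => 1 - X x * q) ν := (integrable_const 1).sub (hint.mul_const q)
  have hquadratic : Integrable (fun x => (X x : ℝ) ^ 2 * q ^ 2) ν := hvar.integrable_sq.mul_const _
  calc pgf X ν (1 - q) ≤ ∫ x, (1 - X x * q + (X x : ℝ) ^ 2 * q ^ 2) ∂ν :=
        integral_mono (integrable_pow_of_mem_Icc hX ⟨by linarith [hq.2], by linarith [hq.1]⟩)
          (hlinear.add hquadratic) fun x => pow_le_one_sub_mul_add_sq hq.1 hq.2 (X x)
    _ = 1 - (∫ x, (X x : ℝ) ∂ν) * q + (∫ x, (X x : ℝ) ^ 2 ∂ν) * q ^ 2 := by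
        rw [integral_add hlinear hquadratic, integral_mul_const,
          integral_sub (integrable_const 1) (hint.mul_const q), integral_mul_const]
        simp

lemma measureReal_le_le_pgf_div_pow (hX : Measurable X) {t : ℝ} (ht0 : 0 < t) (ht1 : t ≤ 1)
    (n : ℕ) : ν.real {x | X x ≤ n} ≤ pgf X ν t / t ^ n := by
  rw [le_div_iff₀ (by positivity), mul_comm]
  calc t ^ n * ν.real {x | X x ≤ n} ≤ t ^ n * ν.real {x | t ^ n ≤ t ^ X x} := by
        gcongr
        · finiteness
        · exact fun hx => pow_le_pow_of_le_one ht0.le ht1 hx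
    _ ≤ pgf X ν t := mul_meas_ge_le_integral_of_nonneg (ae_of_all _ fun x => by positivity)
        (integrable_pow_of_mem_Icc hX ⟨ht0.le, ht1⟩) _

end ProbabilityGeneratingFunction

section GaltonWatson

/-- The law of the child counts of a Galton–Watson tree with offspring distribution `μ`. -/
noncomputable def galtonWatson (μ : Measure ℕ) : Measure (List ℕ → ℕ) :=
  Measure.infinitePi fun _ => μ

/-- The law of the child counts of a sequence of independent Galton–Watson trees with offspring
distribution `μ`. -/
noncomputable def forestLaw (μ : Measure ℕ) : Measure (ℕ → List ℕ → ℕ) :=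
  Measure.infinitePi fun _ => galtonWatson μ

/-- The total weight of the plane tree with child counts `c`, cut at height `h`, when its vertices
have weight `a` below height `h` and weight `b` at height `h`. Both the number of vertices below
height `h` and the number of vertices at height `h` are of this form. -/
def treeWeight (a b : ℕ) : ℕ → (List ℕ → ℕ) → ℕ
  | 0, _ => b
  | h + 1, c => a + ∑ j ∈ Finset.range (c []), treeWeight a b h fun w => c (j :: w)

/-- The number of vertices of height less than `h` in the plane tree with child counts `c`. -/
abbrev truncSize (h : ℕ) (c : List ℕ → ℕ) : ℕ := treeWeight 1 0 h c

/-- The number of vertices of height `h` in the plane tree with child counts `c`. -/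
abbrev generationSize (h : ℕ) (c : List ℕ → ℕ) : ℕ := treeWeight 0 1 h c

/-- The sum of the `treeWeight`s of the first `m` plane trees of a sequence. -/
def forestWeight (a b m h : ℕ) (c : ℕ → List ℕ → ℕ) : ℕ :=
  ∑ k ∈ Finset.range m, treeWeight a b h (c k)

/-- The number of vertices of height less than `h` in the first `m` plane trees of a sequence,
heights being measured from the root of each tree. -/
abbrev forestSize (m h : ℕ) (c : ℕ → List ℕ → ℕ) : ℕ := forestWeight 1 0 m h c

lemma treeWeight_succ (a b h : ℕ) (c : List ℕ → ℕ) :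
    treeWeight a b (h + 1) c = a + forestWeight a b (c []) h fun j w => c (j :: w) :=
  rfl

lemma measurable_sum_range_uncurry {E : Type*} [MeasurableSpace E] {f : E → ℕ}
    (hf : Measurable f) :
    Measurable fun p : ℕ × (ℕ → E) => ∑ k ∈ Finset.range p.1, f (p.2 k) :=
  measurable_from_prod_countable_right fun m =>
    Finset.measurable_fun_sum (Finset.range m) fun k _ => hf.comp (measurable_pi_apply k)

@[fun_prop]
lemma measurable_treeWeight (a b h : ℕ) : Measurable (treeWeight a b h) := by
  induction h with
  | zero => exact measurable_const
  | succ h ih =>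
    have hsum : Measurable fun p : ℕ × (ℕ → List ℕ → ℕ) => forestWeight a b p.1 h p.2 :=
      measurable_sum_range_uncurry ih
    have hsplit : Measurable fun c : List ℕ → ℕ => (c [], fun j w => c (j :: w)) := by fun_prop
    exact (hsum.comp hsplit).const_add a

@[fun_prop]
lemma measurable_forestWeight (a b m h : ℕ) : Measurable (forestWeight a b m h) := by
  unfold forestWeight
  fun_prop

lemma measurable_uncurry_forestWeight (a b h : ℕ) :
    Measurable fun p : ℕ × (ℕ → List ℕ → ℕ) => forestWeight a b p.1 h p.2 :=
  measurable_sum_range_uncurry (measurable_treeWeight a b h)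

variable (μ : Measure ℕ) [IsProbabilityMeasure μ]

instance : IsProbabilityMeasure (galtonWatson μ) := by
  unfold galtonWatson; infer_instance

instance : IsProbabilityMeasure (forestLaw μ) := by
  unfold forestLaw; infer_instance

lemma measurePreserving_eval_forestLaw (k : ℕ) :
    MeasurePreserving (fun c => c k) (forestLaw μ) (galtonWatson μ) :=
  measurePreserving_eval_infinitePi _ k

lemma measurePreserving_split_galtonWatson :
    MeasurePreserving (fun c => (c [], fun j w => c (j :: w))) (galtonWatson μ)
      (μ.prod (forestLaw μ)) :=
  ⟨by fun_prop, map_infinitePi_list μ⟩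

variable {μ} in
lemma hasLaw_forestLaw {Ω : Type*} [MeasurableSpace Ω] {P : Measure Ω}
    {ξ : ℕ → List ℕ → Ω → ℕ} (hlaw : ∀ k w, HasLaw (ξ k w) μ P)
    (hindep : iIndepFun (fun v : ℕ × List ℕ => ξ v.1 v.2) P) :
    HasLaw (fun ω k w => ξ k w ω) (forestLaw μ) P := by
  have huncurried : HasLaw (fun ω (v : ℕ × List ℕ) => ξ v.1 v.2 ω)
      (Measure.infinitePi fun _ : ℕ × List ℕ => μ) P :=
    hindep.hasLaw_infinitePi (fun v => hlaw v.1 v.2)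
      (aemeasurable_pi_iff.2 fun v => (hlaw v.1 v.2).aemeasurable)
  have hcurry : HasLaw (MeasurableEquiv.curry ℕ (List ℕ) ℕ) (forestLaw μ)
      (Measure.infinitePi fun _ : ℕ × List ℕ => μ) :=
    ⟨(MeasurableEquiv.measurable _).aemeasurable,
      Measure.infinitePi_map_curry fun (_ : ℕ) (_ : List ℕ) => μ⟩
  exact hcurry.comp huncurried

variable (a b m h : ℕ)

lemma pgf_forestWeight (t : ℝ) : pgf (forestWeight a b m h) (forestLaw μ) t =
    pgf (treeWeight a b h) (galtonWatson μ) t ^ m := by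
  simp only [pgf, forestWeight, ← Finset.prod_pow_eq_pow_sum]
  have hmeas : Measurable fun c => t ^ treeWeight a b h c := by fun_prop
  exact (integral_finset_prod_infinitePi _ _ fun _ => hmeas).trans (by simp)

lemma pgf_treeWeight_succ {t : ℝ} (ht : t ∈ Set.Icc 0 1) :
    pgf (treeWeight a b (h + 1)) (galtonWatson μ) t =
      t ^ a * pgf id μ (pgf (treeWeight a b h) (galtonWatson μ) t) := by
  have hsplit := measurePreserving_split_galtonWatson μ
  have hmeas := measurable_uncurry_forestWeight a b h
  calc pgf (treeWeight a b (h + 1)) (galtonWatson μ) t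
      = t ^ a * ∫ c, t ^ forestWeight a b (c []) h (fun j w => c (j :: w)) ∂galtonWatson μ := by
        simp only [pgf, treeWeight_succ, pow_add, integral_const_mul]
    _ = t ^ a * ∫ p, t ^ forestWeight a b p.1 h p.2 ∂μ.prod (forestLaw μ) := by
        rw [← hsplit.map_eq, integral_map hsplit.measurable.aemeasurable
          (Measurable.aestronglyMeasurable (by fun_prop))]
    _ = t ^ a * ∫ m, pgf (forestWeight a b m h) (forestLaw μ) t ∂μ := by
        rw [integral_prod _ (integrable_pow_of_mem_Icc hmeas ht)]
        rfl
    _ = t ^ a * pgf id μ (pgf (treeWeight a b h) (galtonWatson μ) t) := by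
        simp only [pgf_forestWeight]
        rfl

lemma lintegral_forestWeight : ∫⁻ c, forestWeight a b m h c ∂forestLaw μ =
    m * ∫⁻ c, treeWeight a b h c ∂galtonWatson μ := by
  have hmeas : Measurable fun c => (treeWeight a b h c : ENNReal) := by fun_prop
  calc ∫⁻ c, forestWeight a b m h c ∂forestLaw μ
      = ∑ k ∈ Finset.range m, ∫⁻ c, treeWeight a b h (c k) ∂forestLaw μ := by
        simp only [forestWeight, Nat.cast_sum]
        exact lintegral_finsetSum _ fun k _ => hmeas.comp (measurable_pi_apply k)
    _ = ∑ _k ∈ Finset.range m, ∫⁻ c, treeWeight a b h c ∂galtonWatson μ :=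
        Finset.sum_congr rfl fun k _ =>
          (measurePreserving_eval_forestLaw μ k).lintegral_comp hmeas
    _ = m * ∫⁻ c, treeWeight a b h c ∂galtonWatson μ := by simp

lemma lintegral_treeWeight : ∫⁻ c, treeWeight a b h c ∂galtonWatson μ =
    a * ∑ i ∈ Finset.range h, (∫⁻ n, n ∂μ) ^ i + b * (∫⁻ n, n ∂μ) ^ h := by
  induction h with
  | zero => simp [treeWeight]
  | succ h ih =>
    have hmeas : Measurable fun p : ℕ × (ℕ → List ℕ → ℕ) =>
        (forestWeight a b p.1 h p.2 : ENNReal) :=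
      Measurable.of_discrete.comp (measurable_uncurry_forestWeight a b h)
    calc ∫⁻ c, treeWeight a b (h + 1) c ∂galtonWatson μ
        = a + ∫⁻ c, forestWeight a b (c []) h (fun j w => c (j :: w)) ∂galtonWatson μ := by
          simp only [treeWeight_succ, Nat.cast_add]
          rw [lintegral_add_left measurable_const, lintegral_const, measure_univ, mul_one]
      _ = a + ∫⁻ p, forestWeight a b p.1 h p.2 ∂μ.prod (forestLaw μ) := by
          rw [(measurePreserving_split_galtonWatson μ).lintegral_comp hmeas]
      _ = a + (∫⁻ n, n ∂μ) * ∫⁻ c, treeWeight a b h c ∂galtonWatson μ := by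
          simp only [lintegral_prod _ hmeas.aemeasurable, lintegral_forestWeight]
          rw [lintegral_mul_const _ (by fun_prop)]
      _ = _ := by
          rw [ih, geom_sum_succ, pow_succ]
          ring

end GaltonWatson

section Critical

lemma lintegral_natCast_eq_one {μ : Measure ℕ} (hmean : ∫ n : ℕ, (n : ℝ) ∂μ = 1) :
    ∫⁻ n : ℕ, (n : ENNReal) ∂μ = 1 := by
  have hint : Integrable (fun n : ℕ => (n : ℝ)) μ := .of_integral_ne_zero (by simp [hmean])
  have h := ofReal_integral_eq_lintegral_ofReal hint (ae_of_all _ fun n => n.cast_nonneg)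
  simpa [hmean] using h.symm

variable {μ : Measure ℕ} [IsProbabilityMeasure μ]

lemma measureReal_two_le_pos (hne : μ ≠ Measure.dirac 1) (hmean : ∫ n : ℕ, (n : ℝ) ∂μ = 1) :
    0 < μ.real {n | 2 ≤ n} := by
  have hint : Integrable (fun n : ℕ => (n : ℝ)) μ := .of_integral_ne_zero (by simp [hmean])
  refine measureReal_nonneg.lt_of_ne' fun hzero => hne ?_
  have hle : ∀ᵐ n ∂μ, n ≤ 1 := by
    rw [measureReal_eq_zero_iff] at hzero
    filter_upwards [measure_eq_zero_iff_ae_notMem.1 hzero] with n hn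
    exact Nat.lt_succ_iff.1 (not_le.1 hn)
  have hnonneg : 0 ≤ᵐ[μ] fun n : ℕ => (1 : ℝ) - n := by
    filter_upwards [hle] with n hn
    simpa using hn
  have hzero : ∫ n : ℕ, ((1 : ℝ) - n) ∂μ = 0 := by
    rw [integral_sub (integrable_const 1) hint, hmean]
    simp
  have hone : ∀ᵐ n ∂μ, n = 1 := by
    filter_upwards [(integral_eq_zero_iff_of_nonneg_ae hnonneg
      ((integrable_const 1).sub hint)).1 hzero] with n hn
    exact_mod_cast (sub_eq_zero.1 hn).symm
  calc μ = μ.map id := Measure.map_id.symm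
    _ = μ.map fun _ => 1 := Measure.map_congr hone
    _ = Measure.dirac 1 := by simp [Measure.map_const]

/-- Kolmogorov's estimate for the survival probability of a critical Galton–Watson tree. -/
lemma measureReal_generationSize_ne_zero_le (hmean : ∫ n : ℕ, (n : ℝ) ∂μ = 1) (h : ℕ) :
    (galtonWatson μ).real {c | generationSize h c ≠ 0} ≤ 1 / (1 + μ.real {n | 2 ≤ n} * h) := by
  have hint : Integrable (fun n : ℕ => (n : ℝ)) μ := .of_integral_ne_zero (by simp [hmean])
  have hmem (h : ℕ) : 1 - pgf (generationSize h) (galtonWatson μ) 0 ∈ Set.Icc 0 1 :=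
    one_sub_pgf_mem_Icc (by fun_prop) (by simp)
  rw [← one_sub_pgf_zero (by fun_prop)]
  refine le_one_div_one_add_mul (q := fun h => 1 - pgf (generationSize h) (galtonWatson μ) 0)
    measureReal_nonneg (fun h => (hmem h).1) (hmem 0).2 (fun h => ?_) h
  have hpgf := le_pgf_one_sub (ν := μ) (X := id) measurable_id hint (hmem h)
  rw [pgf_treeWeight_succ μ 0 1 h (by simp)]
  simp only [id_eq, hmean, sub_sub_cancel] at hpgf
  linarith

/-- The square root singularity at `1` of the generating function of the size of a critical
Galton–Watson tree. -/
lemma exists_pgf_truncSize_one_sub_le (hmean : ∫ n : ℕ, (n : ℝ) ∂μ = 1)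
    (hvar : MemLp (fun n : ℕ => (n : ℝ)) 2 μ) :
    ∃ a > 0, ∀ ε ∈ Set.Ioc (0 : ℝ) 1, ∃ h,
      pgf (truncSize h) (galtonWatson μ) (1 - ε) ≤ 1 - a * √ε := by
  set C := ∫ n : ℕ, (n : ℝ) ^ 2 ∂μ
  have hC : 0 ≤ C := integral_nonneg fun n => sq_nonneg _
  refine ⟨1 / (2 * (C + 1)), by positivity, fun ε ⟨hε0, hε1⟩ => ?_⟩
  by_contra! hlarge
  have hε : 1 - ε ∈ Set.Icc 0 1 := ⟨by linarith, by linarith⟩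
  set q : ℕ → ℝ := fun h => 1 - pgf (truncSize h) (galtonWatson μ) (1 - ε) with hq
  have hmem (h : ℕ) : q h ∈ Set.Icc 0 1 := one_sub_pgf_mem_Icc (by fun_prop) hε
  have hstep (h : ℕ) : q h + ε / 4 ≤ q (h + 1) := by
    have hsmall : 2 * (C + 1) * q h ≤ √ε := by
      have : q h ≤ 1 / (2 * (C + 1)) * √ε := by linarith [hlarge h]
      rwa [one_div_mul_eq_div, le_div_iff₀' (by positivity)] at this
    have hpgf := pgf_one_sub_le (ν := μ) (X := id) measurable_id hvar (hmem h)
    simp only [id_eq, hmean, one_mul] at hpgf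
    calc q h + ε / 4 ≤ 1 - (1 - ε) * (1 - q h + C * q h ^ 2) :=
          add_le_one_sub_one_sub_mul (hmem h).1 hε0.le hε1 hC hsmall
      _ ≤ 1 - (1 - ε) * pgf id μ (1 - q h) := by linarith [mul_le_mul_of_nonneg_left hpgf hε.1]
      _ = q (h + 1) := by simp [hq, pgf_treeWeight_succ μ 1 0 h hε]
  have hgrowth (h : ℕ) : h * (ε / 4) ≤ q h := by
    induction h with
    | zero => simpa using (hmem 0).1
    | succ h ih => push_cast; linarith [hstep h]
  obtain ⟨h, hh⟩ := Archimedean.arch 2 (show 0 < ε / 4 by positivity)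
  rw [nsmul_eq_mul] at hh
  linarith [hgrowth h, (hmem h).2]

lemma measureReal_lt_forestSize_le (hmean : ∫ n : ℕ, (n : ℝ) ∂μ = 1) {n : ℕ} (hn : n ≠ 0)
    (m h : ℕ) : (forestLaw μ).real {c | n < forestSize m h c} ≤ m * h / n := by
  have hmeas : Measurable fun c => (forestSize m h c : ENNReal) :=
    Measurable.of_discrete.comp (measurable_forestWeight 1 0 m h)
  have hmoment : ∫⁻ c, forestSize m h c ∂forestLaw μ = m * h := by
    simp [lintegral_forestWeight, lintegral_treeWeight, lintegral_natCast_eq_one hmean]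
  have hmarkov : forestLaw μ {c | n < forestSize m h c} ≤ m * h / n := by
    calc forestLaw μ {c | n < forestSize m h c}
        ≤ forestLaw μ {c | (n : ENNReal) ≤ forestSize m h c} :=
          measure_mono fun c hc => by
            simp only [Set.mem_ofPred_eq, Nat.cast_le] at hc ⊢
            exact hc.le
      _ ≤ m * h / n := hmoment ▸ meas_ge_le_lintegral_div hmeas.aemeasurable
          (by exact_mod_cast hn) (ENNReal.natCast_ne_top n)
  have hfin : (m * h / n : ENNReal) ≠ ⊤ := by finiteness
  simpa [Measure.real] using ENNReal.toReal_mono hfin hmarkov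

lemma measureReal_exists_generationSize_ne_zero_le (hmean : ∫ n : ℕ, (n : ℝ) ∂μ = 1) (m h : ℕ) :
    (forestLaw μ).real {c | ∃ k < m, generationSize h (c k) ≠ 0} ≤
      m / (1 + μ.real {n | 2 ≤ n} * h) := by
  have hset : {c : ℕ → List ℕ → ℕ | ∃ k < m, generationSize h (c k) ≠ 0} =
      ⋃ k ∈ Finset.range m, {c | generationSize h (c k) ≠ 0} := by
    ext c; simp
  have halive : MeasurableSet {c | generationSize h c ≠ 0} :=
    measurable_treeWeight 0 1 h (measurableSet_singleton 0).compl
  have heval (k : ℕ) : (forestLaw μ).real {c | generationSize h (c k) ≠ 0} =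
      (galtonWatson μ).real {c | generationSize h c ≠ 0} :=
    (measurePreserving_eval_forestLaw μ k).measureReal_preimage halive.nullMeasurableSet
  calc (forestLaw μ).real {c | ∃ k < m, generationSize h (c k) ≠ 0}
      ≤ ∑ k ∈ Finset.range m, (forestLaw μ).real {c | generationSize h (c k) ≠ 0} :=
        hset ▸ measureReal_biUnion_finset_le _ _
    _ = m * (galtonWatson μ).real {c | generationSize h c ≠ 0} := by
        simp only [heval, Finset.sum_const, Finset.card_range, nsmul_eq_mul]
    _ ≤ m * (1 / (1 + μ.real {n | 2 ≤ n} * h)) := by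
        gcongr
        exact measureReal_generationSize_ne_zero_le hmean h
    _ = m / (1 + μ.real {n | 2 ≤ n} * h) := mul_one_div _ _

lemma exists_measureReal_forestSize_le_le (hmean : ∫ n : ℕ, (n : ℝ) ∂μ = 1)
    (hvar : MemLp (fun n : ℕ => (n : ℝ)) 2 μ) :
    ∃ C > 0, ∀ n m : ℕ, n ≠ 0 → m ≠ 0 → ∃ h,
      (forestLaw μ).real {c | forestSize m h c ≤ n} ≤ C * (√n / m) := by
  obtain ⟨a, ha, hsize⟩ := exists_pgf_truncSize_one_sub_le hmean hvar
  refine ⟨4 / a, by positivity, fun n m hn hm => ?_⟩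
  have hn1 : (1 : ℝ) ≤ n := by exact_mod_cast Nat.one_le_iff_ne_zero.2 hn
  set ε : ℝ := 1 / (4 * n) with hε
  have hε0 : 0 < ε := by positivity
  have hε1 : ε < 1 := by
    rw [hε, div_lt_one (by positivity)]
    linarith
  have hsqrt : √ε = 1 / (2 * √n) := by
    rw [hε, Real.sqrt_div zero_le_one, Real.sqrt_one, Real.sqrt_mul (by norm_num),
      show (4 : ℝ) = 2 ^ 2 by norm_num, Real.sqrt_sq (by norm_num)]
  obtain ⟨h, hh⟩ := hsize ε ⟨hε0, hε1.le⟩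
  have hpgf0 := (pgf_mem_Icc (ν := galtonWatson μ) (measurable_treeWeight 1 0 h)
    (t := 1 - ε) ⟨by linarith, by linarith⟩).1
  refine ⟨h, ?_⟩
  have hpow : 1 / 2 ≤ (1 - ε) ^ n := by
    have hbernoulli := one_add_mul_le_pow (a := -ε) (by linarith) n
    have hnε : (n : ℝ) * ε = 1 / 4 := by rw [hε]; field_simp
    rw [sub_eq_add_neg]
    linarith
  calc (forestLaw μ).real {c | forestSize m h c ≤ n}
      ≤ pgf (forestSize m h) (forestLaw μ) (1 - ε) / (1 - ε) ^ n :=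
        measureReal_le_le_pgf_div_pow (by fun_prop) (by linarith) (by linarith) n
    _ ≤ (1 - a * √ε) ^ m / (1 / 2) := by
        rw [pgf_forestWeight]
        have := pow_nonneg (hpgf0.trans hh) m
        gcongr
    _ ≤ 1 / (m * (a * √ε)) / (1 / 2) := by
        gcongr
        exact one_sub_pow_le_one_div (by positivity) (by linarith) hm
    _ = 4 / a * (√n / m) := by
        rw [hsqrt]
        field_simp
        norm_num

end Critical

section AlmostSureGrowth

lemma ae_eventually_notMem_of_geometric {E : Type*} [MeasurableSpace E] {ν : Measure E}
    [IsFiniteMeasure ν] {s : ℕ → Set E} {C r : ℝ} (hr0 : 0 ≤ r) (hr1 : r < 1)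
    (hs : ∀ j, ν.real (s j) ≤ C * r ^ j) : ∀ᵐ x ∂ν, ∀ᶠ j in atTop, x ∉ s j := by
  have hsum : Summable fun j => ν.real (s j) :=
    Summable.of_nonneg_of_le (fun _ => measureReal_nonneg) hs
      ((summable_geometric_of_lt_one hr0 hr1).mul_left C)
  have htsum : ∑' j, ν (s j) = ∑' j, ENNReal.ofReal (ν.real (s j)) :=
    tsum_congr fun _ => (ofReal_measureReal).symm
  exact ae_eventually_notMem (htsum ▸ hsum.tsum_ofReal_ne_top)

variable {μ : Measure ℕ} [IsProbabilityMeasure μ]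

lemma ae_eventually_forestSize_le (hmean : ∫ n : ℕ, (n : ℝ) ∂μ = 1) {θ : ℝ} (h1 : 1 < θ)
    (h2 : θ ≤ 2) : ∀ᵐ c ∂forestLaw μ, ∀ᶠ j in atTop,
      forestSize ⌈(2 / θ) ^ j⌉₊ ⌈(2 / θ) ^ j⌉₊ c ≤ 4 ^ j := by
  have hceil (j : ℕ) : (⌈(2 / θ) ^ j⌉₊ : ℝ) ≤ 2 * (2 / θ) ^ j :=
    natCast_ceil_le_two_mul (one_le_pow₀ ((one_le_div (by linarith)).2 h2))
  have hbound (j : ℕ) :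
      (forestLaw μ).real {c | 4 ^ j < forestSize ⌈(2 / θ) ^ j⌉₊ ⌈(2 / θ) ^ j⌉₊ c} ≤
        4 * (1 / θ ^ 2) ^ j := by
    calc (forestLaw μ).real {c | 4 ^ j < forestSize ⌈(2 / θ) ^ j⌉₊ ⌈(2 / θ) ^ j⌉₊ c}
        ≤ ⌈(2 / θ) ^ j⌉₊ * ⌈(2 / θ) ^ j⌉₊ / (4 ^ j : ℕ) :=
          measureReal_lt_forestSize_le hmean (by positivity) _ _
      _ ≤ (2 * (2 / θ) ^ j) * (2 * (2 / θ) ^ j) / (4 ^ j : ℕ) := by gcongr <;> exact hceil j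
      _ = 4 * ((2 / θ) * (2 / θ) / 4) ^ j := by
          rw [div_pow _ 4, mul_pow (2 / θ)]
          push_cast
          ring
      _ = 4 * (1 / θ ^ 2) ^ j := by
          congr 2
          field_simp
          norm_num
  filter_upwards [ae_eventually_notMem_of_geometric (by positivity)
    ((div_lt_one (by positivity)).2 (one_lt_pow₀ h1 two_ne_zero)) hbound] with c hc
  exact hc.mono fun j hj => not_lt.1 hj

lemma ae_eventually_exists_lt_forestSize (hmean : ∫ n : ℕ, (n : ℝ) ∂μ = 1)
    (hvar : MemLp (fun n : ℕ => (n : ℝ)) 2 μ) {θ : ℝ} (h1 : 1 < θ) :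
    ∀ᵐ c ∂forestLaw μ, ∀ᶠ j in atTop, ∃ h, 4 ^ j < forestSize ⌈(2 * θ) ^ j⌉₊ h c := by
  obtain ⟨C, hC, hsize⟩ := exists_measureReal_forestSize_le_le hmean hvar
  choose H hH using fun j : ℕ => hsize (4 ^ j) ⌈(2 * θ) ^ j⌉₊ (by positivity)
    (Nat.ceil_pos.2 (by positivity)).ne'
  have hbound (j : ℕ) :
      (forestLaw μ).real {c | forestSize ⌈(2 * θ) ^ j⌉₊ (H j) c ≤ 4 ^ j} ≤ C * (1 / θ) ^ j := by
    have hsqrt : √((4 ^ j : ℕ) : ℝ) = 2 ^ j := by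
      rw [show 4 ^ j = (2 ^ j) ^ 2 by rw [← pow_mul', pow_mul]; norm_num]
      simp
    calc (forestLaw μ).real {c | forestSize ⌈(2 * θ) ^ j⌉₊ (H j) c ≤ 4 ^ j}
        ≤ C * (2 ^ j / ⌈(2 * θ) ^ j⌉₊) := hsqrt ▸ hH j
      _ ≤ C * (2 ^ j / (2 * θ) ^ j) := by
          gcongr
          exact Nat.le_ceil _
      _ = C * (1 / θ) ^ j := by
          rw [← div_pow]
          congr 2
          field_simp
  filter_upwards [ae_eventually_notMem_of_geometric (by positivity)
    ((div_lt_one (by positivity)).2 h1) hbound] with c hc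
  exact hc.mono fun j hj => ⟨H j, not_le.1 hj⟩

lemma ae_eventually_generationSize_eq_zero (hne : μ ≠ Measure.dirac 1)
    (hmean : ∫ n : ℕ, (n : ℝ) ∂μ = 1) {θ : ℝ} (h1 : 1 < θ) : ∀ᵐ c ∂forestLaw μ,
      ∀ᶠ j in atTop, ∀ k < ⌈(2 * θ) ^ j⌉₊, generationSize ⌈(2 * θ ^ 2) ^ j⌉₊ (c k) = 0 := by
  set p := μ.real {n | 2 ≤ n}
  have hp : 0 < p := measureReal_two_le_pos hne hmean
  have hceil (j : ℕ) : (⌈(2 * θ) ^ j⌉₊ : ℝ) ≤ 2 * (2 * θ) ^ j :=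
    natCast_ceil_le_two_mul (one_le_pow₀ (by linarith))
  have hbound (j : ℕ) : (forestLaw μ).real
      {c | ∃ k < ⌈(2 * θ) ^ j⌉₊, generationSize ⌈(2 * θ ^ 2) ^ j⌉₊ (c k) ≠ 0} ≤
        2 / p * (1 / θ) ^ j := by
    calc (forestLaw μ).real
          {c | ∃ k < ⌈(2 * θ) ^ j⌉₊, generationSize ⌈(2 * θ ^ 2) ^ j⌉₊ (c k) ≠ 0}
        ≤ ⌈(2 * θ) ^ j⌉₊ / (1 + p * ⌈(2 * θ ^ 2) ^ j⌉₊) :=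
          measureReal_exists_generationSize_ne_zero_le hmean _ _
      _ ≤ 2 * (2 * θ) ^ j / (p * (2 * θ ^ 2) ^ j) := by
          gcongr
          · exact hceil j
          · linarith [mul_le_mul_of_nonneg_left (Nat.le_ceil ((2 * θ ^ 2) ^ j)) hp.le]
      _ = 2 / p * (1 / θ) ^ j := by
          rw [mul_div_mul_comm, ← div_pow]
          congr 2
          field_simp
  filter_upwards [ae_eventually_notMem_of_geometric (by positivity)
    ((div_lt_one (by positivity)).2 h1) hbound] with c hc
  filter_upwards [hc] with j hj k hk
  by_contra halive
  exact hj ⟨k, hk, halive⟩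

end AlmostSureGrowth

section PlaneTree

lemma nil_mem_planeTree (c : List ℕ → ℕ) : [] ∈ planeTree c := fun p j h => by simp at h

lemma cons_mem_planeTree {c : List ℕ → ℕ} {j : ℕ} {w : List ℕ} :
    j :: w ∈ planeTree c ↔ j < c [] ∧ w ∈ planeTree fun w => c (j :: w) := by
  refine ⟨fun h => ⟨h [] j (by simp), fun p i hp => h (j :: p) i (by simpa using hp)⟩, ?_⟩
  rintro ⟨hj, hw⟩ (_ | ⟨i, p⟩) i' hp
  · obtain rfl : i' = j := by simpa using hp
    exact hj
  · rw [List.cons_append, List.cons_prefix_cons] at hp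
    obtain ⟨rfl, hp⟩ := hp
    exact hw p i' hp

lemma mem_planeTree_of_append_mem {c : List ℕ → ℕ} {w v : List ℕ} (h : w ++ v ∈ planeTree c) :
    w ∈ planeTree c :=
  fun p j hp => h p j (hp.trans (List.prefix_append _ _))

/-- The vertices of height less than `h` of the plane tree with child counts `c`. -/
def truncTree : ℕ → (List ℕ → ℕ) → Finset (List ℕ)
  | 0, _ => ∅
  | h + 1, c => insert [] ((Finset.range (c [])).biUnion fun j =>
      (truncTree h fun w => c (j :: w)).image (List.cons j))

lemma mem_truncTree {h : ℕ} {c : List ℕ → ℕ} {w : List ℕ} :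
    w ∈ truncTree h c ↔ w ∈ planeTree c ∧ w.length < h := by
  induction h generalizing c w with
  | zero => simp [truncTree]
  | succ h ih =>
    cases w with
    | nil => simp [truncTree, nil_mem_planeTree]
    | cons j w => simp [truncTree, ih, cons_mem_planeTree, and_assoc]

lemma card_truncTree (h : ℕ) (c : List ℕ → ℕ) : (truncTree h c).card = truncSize h c := by
  induction h generalizing c with
  | zero => rfl
  | succ h ih =>
    have hdisj : (Finset.range (c []) : Set ℕ).PairwiseDisjoint fun j =>
        (truncTree h fun w => c (j :: w)).image (List.cons j) := fun i _ j _ hij => by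
      simp only [Function.onFun, Finset.disjoint_left, Finset.mem_image]
      rintro _ ⟨v, _, rfl⟩ ⟨w, _, hw⟩
      exact hij (List.cons.inj hw).1.symm
    rw [truncTree, Finset.card_insert_of_notMem (by simp), Finset.card_biUnion hdisj, add_comm]
    simp only [Finset.card_image_of_injective _ List.cons_injective, ih]
    rfl

lemma length_lt_of_generationSize_eq_zero {h : ℕ} {c : List ℕ → ℕ} (hc : generationSize h c = 0)
    {w : List ℕ} (hw : w ∈ planeTree c) : w.length < h := by
  induction h generalizing c w with
  | zero => simp [treeWeight] at hc
  | succ h ih =>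
    cases w with
    | nil => simp
    | cons j w =>
      rw [cons_mem_planeTree] at hw
      simp only [treeWeight, zero_add, Finset.sum_eq_zero_iff, Finset.mem_range] at hc
      simpa using ih (hc j hw.1) hw.2

lemma finite_planeTree_of_generationSize_eq_zero {h : ℕ} {c : List ℕ → ℕ}
    (hc : generationSize h c = 0) : (planeTree c).Finite :=
  (truncTree h c).finite_toSet.subset fun _ hw =>
    mem_truncTree.2 ⟨hw, length_lt_of_generationSize_eq_zero hc hw⟩

/-- The vertices of height less than `h` of the first `m` trees of the forest with child counts
`c`, heights being measured from the root of each tree. -/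
def truncForest (m h : ℕ) (c : ℕ → List ℕ → ℕ) : Finset (ℕ ×ₗ List ℕ) :=
  ((Finset.range m).sigma fun k => truncTree h (c k)).map
    ((Equiv.sigmaEquivProd ℕ (List ℕ)).trans toLex).toEmbedding

lemma mem_truncForest {m h : ℕ} {c : ℕ → List ℕ → ℕ} {v : ℕ ×ₗ List ℕ} :
    v ∈ truncForest m h c ↔ (ofLex v).1 < m ∧ v ∈ forest c ∧ (ofLex v).2.length < h := by
  rw [truncForest, Finset.mem_map_equiv, Finset.mem_sigma, Finset.mem_range, mem_truncTree]
  rfl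

lemma card_truncForest (m h : ℕ) (c : ℕ → List ℕ → ℕ) :
    (truncForest m h c).card = forestSize m h c := by
  simp [truncForest, card_truncTree, forestWeight]

end PlaneTree

section ForestOrder

lemma nonempty_orderIso_nat {α : Type*} [LinearOrder α] [OrderBot α] [NoMaxOrder α]
    (hfin : ∀ a : α, (Set.Iic a).Finite) : Nonempty (ℕ ≃o α) := by
  let _ : LocallyFiniteOrder α :=
    LocallyFiniteOrder.ofFiniteIcc fun _ b => (hfin b).subset Set.Icc_subset_Iic_self
  let _ := LinearLocallyFiniteOrder.succOrder α
  let _ := LinearLocallyFiniteOrder.predOrder α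
  exact ⟨orderIsoNatOfLinearSuccPredArch.symm⟩

variable {c : ℕ → List ℕ → ℕ}

lemma forest_lt_iff {u v : forest c} : u < v ↔ (ofLex u.1).1 < (ofLex v.1).1 ∨
    (ofLex u.1).1 = (ofLex v.1).1 ∧ (ofLex u.1).2 < (ofLex v.1).2 :=
  Prod.Lex.lt_iff

instance : OrderBot (forest c) where
  bot := forestRoot c
  bot_le v := by
    refine not_lt.1 fun h => ?_
    rcases forest_lt_iff.1 h with h | ⟨_, h⟩
    · exact Nat.not_lt_zero _ h
    · exact List.not_lt_nil _ h

instance : NoMaxOrder (forest c) where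
  exists_gt v := ⟨⟨toLex ((ofLex v.1).1 + 1, []), nil_mem_planeTree _⟩,
    forest_lt_iff.2 (Or.inl (Nat.lt_succ_self _))⟩

lemma finite_Iic_forest (hfin : ∀ k, (planeTree (c k)).Finite) (v : forest c) :
    (Set.Iic v).Finite := by
  have htrees : (⋃ k ∈ Set.Iic (ofLex v.1).1,
      (fun w => toLex (k, w)) '' planeTree (c k)).Finite :=
    (Set.finite_Iic _).biUnion fun k _ => (hfin k).image _
  refine (htrees.preimage Subtype.val_injective.injOn).subset fun u hu => ?_
  have hindex : (ofLex u.1).1 ≤ (ofLex v.1).1 :=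
    Prod.Lex.monotone_fst_ofLex hu
  exact Set.mem_biUnion hindex ⟨_, u.2, rfl⟩

end ForestOrder

section ForestHeight

/-- The height of a vertex of the forest, counted along the spine. -/
def forestHeight (v : ℕ ×ₗ List ℕ) : ℕ := (ofLex v).1 + (ofLex v).2.length

variable {c : ℕ → List ℕ → ℕ}

lemma forestHeight_forestRoot : forestHeight (forestRoot c) = 0 := rfl

lemma forestHeight_of_isParent {u v : ℕ ×ₗ List ℕ} (h : IsParent u v) :
    forestHeight v = forestHeight u + 1 := by
  rcases h with ⟨k, w, j, rfl, rfl⟩ | ⟨k, rfl, rfl⟩ <;> simp [forestHeight, add_assoc]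

lemma lt_of_isParent {u v : ℕ ×ₗ List ℕ} (h : IsParent u v) : u < v := by
  rcases h with ⟨k, w, j, rfl, rfl⟩ | ⟨k, rfl, rfl⟩
  · exact Prod.Lex.toLex_lt_toLex.2 (Or.inr ⟨rfl, by
      simpa using List.append_left_lt (l₁ := w) (List.nil_lt_cons j [])⟩)
  · exact Prod.Lex.toLex_lt_toLex.2 (Or.inl (Nat.lt_succ_self k))

lemma exists_isParent {v : forest c} (hv : v ≠ forestRoot c) :
    ∃ u : forest c, IsParent (u : ℕ ×ₗ List ℕ) v := by
  obtain ⟨⟨k, w⟩, hw⟩ := v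
  rcases w.eq_nil_or_concat' with rfl | ⟨w, j, rfl⟩
  · obtain _ | k := k
    · exact absurd rfl hv
    · exact ⟨⟨toLex (k, []), nil_mem_planeTree _⟩, Or.inr ⟨k, rfl, rfl⟩⟩
  · exact ⟨⟨toLex (k, w), mem_planeTree_of_append_mem hw⟩, Or.inl ⟨k, w, j, rfl, rfl⟩⟩

lemma forestGraph_adj {u v : forest c} : (forestGraph c).Adj u v ↔
    IsParent (u : ℕ ×ₗ List ℕ) v ∨ IsParent (v : ℕ ×ₗ List ℕ) u := by
  rw [forestGraph, SimpleGraph.fromRel_adj, and_iff_right_iff_imp]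
  rintro (h | h) rfl <;> exact (lt_of_isParent h).false

lemma forestHeight_le_add_length {u v : forest c} (p : (forestGraph c).Walk u v) :
    forestHeight v ≤ forestHeight u + p.length := by
  induction p with
  | nil => simp
  | cons h p ih =>
    rw [SimpleGraph.Walk.length_cons]
    rcases forestGraph_adj.1 h with h | h <;> have := forestHeight_of_isParent h <;> lia

lemma exists_walk_length_eq_forestHeight (v : forest c) :
    ∃ p : (forestGraph c).Walk (forestRoot c) v, p.length = forestHeight v := by
  induction hn : forestHeight (v : ℕ ×ₗ List ℕ) generalizing v with
  | zero =>
    obtain rfl : v = forestRoot c := by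
      by_contra hv
      obtain ⟨u, hu⟩ := exists_isParent hv
      simp [forestHeight_of_isParent hu] at hn
    exact ⟨.nil, rfl⟩
  | succ n ih =>
    have hv : v ≠ forestRoot c := by
      rintro rfl
      simp [forestHeight_forestRoot] at hn
    obtain ⟨u, hu⟩ := exists_isParent hv
    obtain ⟨p, hp⟩ := ih u (by simpa [forestHeight_of_isParent hu] using hn)
    exact ⟨p.concat (forestGraph_adj.2 (Or.inl hu)), by simp [hp]⟩

lemma dist_forestRoot (v : forest c) :
    (forestGraph c).dist (forestRoot c) v = forestHeight v := by
  obtain ⟨p, hp⟩ := exists_walk_length_eq_forestHeight v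
  obtain ⟨q, hq⟩ := p.reachable.exists_walk_length_eq_dist
  refine le_antisymm (hp ▸ SimpleGraph.dist_le p) ?_
  simpa [hq, forestHeight_forestRoot] using forestHeight_le_add_length q

lemma orderIso_zero (u : ℕ ≃o forest c) : u 0 = forestRoot c := u.map_bot

lemma forestHeight_orderIso_zero (u : ℕ ≃o forest c) : forestHeight (u 0) = 0 := by
  rw [orderIso_zero, forestHeight_forestRoot]

lemma forestHeight_orderIso_one (u : ℕ ≃o forest c) : forestHeight (u 1) = 1 := by
  have hroot : u 1 ≠ forestRoot c := by
    rw [← orderIso_zero u, u.injective.ne_iff]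
    exact one_ne_zero
  obtain ⟨v, hv⟩ := exists_isParent hroot
  obtain ⟨i, rfl⟩ := u.surjective v
  obtain rfl : i = 0 := Nat.lt_one_iff.1 (u.lt_iff_lt.1 (lt_of_isParent hv))
  rw [forestHeight_of_isParent hv, forestHeight_orderIso_zero]

end ForestHeight

section MaxHeight

variable {c : ℕ → List ℕ → ℕ}

/-- The largest height among the vertices `u 0, …, u n`. -/
def maxHeight (u : ℕ ≃o forest c) (n : ℕ) : ℕ :=
  (Finset.range (n + 1)).sup fun i => forestHeight (u i)

lemma monotone_maxHeight (u : ℕ ≃o forest c) : Monotone (maxHeight u) := fun _ _ h =>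
  Finset.sup_mono (Finset.range_subset_range.2 (Nat.succ_le_succ h))

lemma maxHeight_zero (u : ℕ ≃o forest c) : maxHeight u 0 = 0 := by
  simp [maxHeight, forestHeight_orderIso_zero]

lemma maxHeight_one (u : ℕ ≃o forest c) : maxHeight u 1 = 1 := by
  simp [maxHeight, Finset.range_add_one, forestHeight_orderIso_zero, forestHeight_orderIso_one]

lemma maxHeight_pos (u : ℕ ≃o forest c) {n : ℕ} (hn : n ≠ 0) : 0 < maxHeight u n := by
  have hle := monotone_maxHeight u (Nat.one_le_iff_ne_zero.2 hn)
  rw [maxHeight_one] at hle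
  exact hle

lemma le_maxHeight_of_forestSize_le (u : ℕ ≃o forest c) {h n : ℕ} (hn : forestSize h h c ≤ n) :
    h ≤ maxHeight u n := by
  by_contra! hlt
  have hsub : (Finset.range (n + 1)).map (u.toEmbedding.trans (.subtype _)) ⊆
      truncForest h h c := by
    intro v hv
    obtain ⟨i, hi, rfl⟩ := Finset.mem_map.1 hv
    have hheight : forestHeight (u i) < h :=
      (Finset.le_sup (f := fun i => forestHeight (u i)) hi).trans_lt hlt
    exact mem_truncForest.2 ⟨(Nat.le_add_right _ _).trans_lt hheight, (u i).2,
      (Nat.le_add_left _ _).trans_lt hheight⟩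
  have hcard := Finset.card_le_card hsub
  rw [Finset.card_map, Finset.card_range, card_truncForest] at hcard
  lia

lemma fst_lt_of_lt_forestSize (u : ℕ ≃o forest c) {m h i : ℕ} (hi : i < forestSize m h c) :
    (ofLex (u i).1).1 < m := by
  by_contra! hm
  have hsub : truncForest m h c ⊆
      (Finset.range i).map (u.toEmbedding.trans (.subtype _)) := by
    intro v hv
    obtain ⟨hvm, hvc, -⟩ := mem_truncForest.1 hv
    obtain ⟨i', hi'⟩ := u.surjective ⟨v, hvc⟩
    have hlt : u i' < u i := hi' ▸ forest_lt_iff.2 (Or.inl (hvm.trans_le hm))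
    exact Finset.mem_map.2 ⟨i', Finset.mem_range.2 (u.lt_iff_lt.1 hlt), congrArg Subtype.val hi'⟩
  have hcard := Finset.card_le_card hsub
  rw [Finset.card_map, Finset.card_range, card_truncForest] at hcard
  lia

lemma maxHeight_le_add (u : ℕ ≃o forest c) {m h h' n : ℕ} (hn : n < forestSize m h c)
    (hc : ∀ k < m, generationSize h' (c k) = 0) : maxHeight u n ≤ m + h' := by
  refine Finset.sup_le fun i hi => ?_
  have hk : (ofLex (u i).1).1 < m :=
    fst_lt_of_lt_forestSize u ((Nat.lt_succ_iff.1 (Finset.mem_range.1 hi)).trans_lt hn)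
  exact add_le_add hk.le (length_lt_of_generationSize_eq_zero (hc _ hk) (u i).2).le

end MaxHeight

section GrowthExponent

lemma monotone_log_maxHeight {c : ℕ → List ℕ → ℕ} (u : ℕ ≃o forest c) :
    Monotone fun n => Real.log (maxHeight u n) := fun m n hmn => by
  have hle : (maxHeight u m : ℝ) ≤ maxHeight u n := by exact_mod_cast monotone_maxHeight u hmn
  rcases Nat.eq_zero_or_pos (maxHeight u m) with hm | hm
  · simpa [hm] using Real.log_natCast_nonneg (maxHeight u n)
  · exact Real.log_le_log (by exact_mod_cast hm) hle

variable {μ : Measure ℕ} [IsProbabilityMeasure μ]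

lemma ae_forall_finite_planeTree (hne : μ ≠ Measure.dirac 1) (hmean : ∫ n : ℕ, (n : ℝ) ∂μ = 1) :
    ∀ᵐ c ∂forestLaw μ, ∀ k, (planeTree (c k)).Finite := by
  filter_upwards [ae_eventually_generationSize_eq_zero hne hmean one_lt_two] with c hc k
  have hindex : ∀ᶠ j : ℕ in atTop, (k : ℝ) < (2 * 2) ^ j :=
    (tendsto_pow_atTop_atTop_of_one_lt (by norm_num)).eventually_gt_atTop _
  obtain ⟨j, hj, hk⟩ := (hc.and hindex).exists
  exact finite_planeTree_of_generationSize_eq_zero (hj k (Nat.lt_ceil.2 hk))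

lemma ae_eventually_le_maxHeight (hmean : ∫ n : ℕ, (n : ℝ) ∂μ = 1) {θ : ℝ} (h1 : 1 < θ)
    (h2 : θ ≤ 2) : ∀ᵐ c ∂forestLaw μ, ∀ u : ℕ ≃o forest c, ∀ᶠ j in atTop,
      (2 / θ) ^ j ≤ maxHeight u (4 ^ j) := by
  filter_upwards [ae_eventually_forestSize_le hmean h1 h2] with c hc u
  filter_upwards [hc] with j hj
  exact Nat.ceil_le.1 (le_maxHeight_of_forestSize_le u hj)

lemma ae_eventually_maxHeight_le (hne : μ ≠ Measure.dirac 1)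
    (hmean : ∫ n : ℕ, (n : ℝ) ∂μ = 1) (hvar : MemLp (fun n : ℕ => (n : ℝ)) 2 μ) {θ : ℝ}
    (h1 : 1 < θ) : ∀ᵐ c ∂forestLaw μ, ∀ u : ℕ ≃o forest c, ∀ᶠ j in atTop,
      maxHeight u (4 ^ j) ≤ 4 * (2 * θ ^ 2) ^ j := by
  have hθ : θ ≤ θ ^ 2 := le_self_pow₀ h1.le two_ne_zero
  filter_upwards [ae_eventually_exists_lt_forestSize hmean hvar h1,
    ae_eventually_generationSize_eq_zero hne hmean h1] with c hsize hextinct u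
  filter_upwards [hsize, hextinct] with j ⟨h, hj⟩ hj'
  calc (maxHeight u (4 ^ j) : ℝ) ≤ ⌈(2 * θ) ^ j⌉₊ + ⌈(2 * θ ^ 2) ^ j⌉₊ := by
        exact_mod_cast maxHeight_le_add u hj hj'
    _ ≤ 2 * (2 * θ) ^ j + 2 * (2 * θ ^ 2) ^ j := by
        gcongr <;> exact natCast_ceil_le_two_mul (one_le_pow₀ (by linarith))
    _ ≤ 2 * (2 * θ ^ 2) ^ j + 2 * (2 * θ ^ 2) ^ j := by gcongr
    _ = 4 * (2 * θ ^ 2) ^ j := by ring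

lemma ae_tendsto_log_maxHeight_div_log (hne : μ ≠ Measure.dirac 1)
    (hmean : ∫ n : ℕ, (n : ℝ) ∂μ = 1) (hvar : MemLp (fun n : ℕ => (n : ℝ)) 2 μ) :
    ∀ᵐ c ∂forestLaw μ, ∀ u : ℕ ≃o forest c,
      Tendsto (fun n : ℕ => Real.log (maxHeight u n) / Real.log n) atTop (𝓝 (1 / 2)) := by
  obtain ⟨θ, -, hθ, hlim⟩ := exists_seq_strictAnti_tendsto' (one_lt_two (α := ℝ))
  have hlower : Tendsto (fun i => 2 / θ i) atTop (𝓝 2) := by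
    simpa [div_eq_mul_inv] using (hlim.inv₀ one_ne_zero).const_mul 2
  have hupper : Tendsto (fun i => 2 * θ i ^ 2) atTop (𝓝 2) := by
    simpa using (hlim.pow 2).const_mul 2
  filter_upwards [ae_all_iff.2 fun i => ae_eventually_le_maxHeight hmean (hθ i).1 (hθ i).2.le,
    ae_all_iff.2 fun i => ae_eventually_maxHeight_le hne hmean hvar (hθ i).1] with c hle hge u
  have hpowers : Tendsto (fun j : ℕ => Real.log (maxHeight u (4 ^ j)) / j) atTop
      (𝓝 (Real.log 2)) :=
    tendsto_log_div_of_geometric_bounds two_pos four_pos hlower hupper (fun i => hle i u)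
      fun i => hge i u
  convert tendsto_div_log_of_monotone (monotone_log_maxHeight u)
    (fun n => Real.log_natCast_nonneg _) (b := 4) (by norm_num) hpowers using 2
  rw [show ((4 : ℕ) : ℝ) = 2 ^ 2 by norm_num, Real.log_pow]
  field_simp
  norm_num

end GrowthExponent

theorem lemma2p4 {Ω : Type*} [MeasurableSpace Ω] (P : Measure Ω) [IsProbabilityMeasure P]
    (μ : Measure ℕ) [IsProbabilityMeasure μ] (hμ_ne : μ ≠ Measure.dirac 1)
    (hμ_var : MemLp (fun k : ℕ => (k : ℝ)) 2 μ) (hμ_mean : ∫ k : ℕ, (k : ℝ) ∂μ = 1)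
    (ξ : ℕ → List ℕ → Ω → ℕ) (hξ_law : ∀ k w, HasLaw (ξ k w) μ P)
    (hξ_indep : iIndepFun (fun v : ℕ × List ℕ => ξ v.1 v.2) P) :
    ∀ᵐ ω ∂P,
      Nonempty (ℕ ≃o forest fun k w => ξ k w ω) ∧
      ∀ u : ℕ ≃o forest fun k w => ξ k w ω,
        ∃ ε : ℕ → ℝ, Tendsto ε atTop (𝓝 0) ∧ ∀ n : ℕ,
          (((Finset.range (n + 1)).sup fun i =>
            (forestGraph fun k w => ξ k w ω).dist (forestRoot fun k w => ξ k w ω) (u i) : ℕ) : ℝ)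
            = (n : ℝ) ^ (1 / 2 + ε n) := by
  have hlaw := hasLaw_forestLaw hξ_law hξ_indep
  have hgrowth : ∀ᵐ c ∂forestLaw μ, (∀ k, (planeTree (c k)).Finite) ∧ ∀ u : ℕ ≃o forest c,
      Tendsto (fun n : ℕ => Real.log (maxHeight u n) / Real.log n) atTop (𝓝 (1 / 2)) :=
    (ae_forall_finite_planeTree hμ_ne hμ_mean).and
      (ae_tendsto_log_maxHeight_div_log hμ_ne hμ_mean hμ_var)
  rw [← hlaw.map_eq] at hgrowth
  filter_upwards [ae_of_ae_map hlaw.aemeasurable hgrowth] with ω ⟨hfinite, hexponent⟩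
  refine ⟨nonempty_orderIso_nat (finite_Iic_forest hfinite), fun u => ?_⟩
  simp only [dist_forestRoot]
  exact exists_eq_rpow_add_of_tendsto_log_div_log (f := fun n => maxHeight u n) (by norm_num)
    (by simp [maxHeight_zero]) (by simp [maxHeight_one])
    (fun n hn => by exact_mod_cast maxHeight_pos u hn) (hexponent u)
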